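/- Let $n\ge 0$ and $k\ge 3$ be integers. Two permutations of $[n]=\{1,2,\dots,n\}$ (read as words listing the elements of $[n]$ in some order) are called $k$-neighbor separated if there are two elements of $[n]$ that are neighbors in one of the permutations and that are separated by exactly $k-2$ other elements in the other one. Let $P(n,k)$ denote the maximal number of pairwise $k$-neighbor separated permutations of $[n]$, and let $P(k):=\lim_{n\to\infty}\sqrt[n]{P(n,k)}$ when this limit exists. **Theorem.** For every positive integer $\ell$, the limit $P(2^\ell+1)=\lim_{n\to\infty}\sqrt[n]{P(n,2^\ell+1)}$ exists and equals $2$; that is, $P(n,2^\ell+1)=2^{n-o(n)}$ as $n\to\infty$, for every fixed $\ell$. -/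

import Mathlib

open scoped Asymptotics

/-- A permutation `π` of an `n`-element set (here `Fin n`) is read as the word
`π 0, π 1, …, π (n - 1)`, so the element `x` stands at position `π.symm x`.
`posDist π x y` is the distance of the positions of `x` and `y` in this word: it is `1` when
`x` and `y` are neighbors, and `m + 1` when they are separated by exactly `m` other elements. -/
def posDist {n : ℕ} (π : Equiv.Perm (Fin n)) (x y : Fin n) : ℕ :=
  Nat.dist (π.symm x : ℕ) (π.symm y : ℕ)

/-- There are two elements that are neighbors in one of the two permutations and that are
separated by exactly `k - 2` other elements in the other one (position distance `k - 1`). -/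
def NeighborSeparated {n : ℕ} (k : ℕ) (π σ : Equiv.Perm (Fin n)) : Prop :=
  ∃ x y : Fin n,
    (posDist π x y = 1 ∧ posDist σ x y + 1 = k) ∨ (posDist σ x y = 1 ∧ posDist π x y + 1 = k)

/-- A family of permutations any two distinct members of which are `k`-neighbor separated. -/
def IsSeparatedFamily {n : ℕ} (k : ℕ) (F : Finset (Equiv.Perm (Fin n))) : Prop :=
  (F : Set (Equiv.Perm (Fin n))).Pairwise (NeighborSeparated k)

/-- `P(n, k)`: the maximal number of pairwise `k`-neighbor separated permutations of an
`n`-element set. -/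
noncomputable def maxSeparated (n k : ℕ) : ℕ :=
  sSup {m : ℕ | ∃ F : Finset (Equiv.Perm (Fin n)), IsSeparatedFamily k F ∧ F.card = m}

/-- The supremum in the definition of `maxSeparated` is a maximum. -/
theorem maxSeparated_isGreatest (n k : ℕ) :
    IsGreatest {m : ℕ | ∃ F : Finset (Equiv.Perm (Fin n)), IsSeparatedFamily k F ∧ F.card = m}
      (maxSeparated n k) := by
  have hb : BddAbove
      {m : ℕ | ∃ F : Finset (Equiv.Perm (Fin n)), IsSeparatedFamily k F ∧ F.card = m} := by
    refine ⟨Fintype.card (Equiv.Perm (Fin n)), ?_⟩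
    rintro m ⟨F, -, rfl⟩
    exact F.card_le_univ
  have hne : Set.Nonempty
      {m : ℕ | ∃ F : Finset (Equiv.Perm (Fin n)), IsSeparatedFamily k F ∧ F.card = m} :=
    ⟨0, ∅, by simp [IsSeparatedFamily], rfl⟩
  exact ⟨Nat.sSup_mem hne hb, fun m hm => le_csSup hb hm⟩

/-! Put d = 2^l, so that separation means adjacent in one word and at distance d in the other. Upper
bound: d is even, so parities of positions tell separated words apart, giving at most 2^n of them
(`maxSeparated_le_two_pow`).

Lower bound: letters are grouped into h × w arrays with w dividing d, whose rows must stay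
contiguous and whose consecutive rows must lie d apart. The arrays are paired; half of the pairs are
stacked, the others are put side by side. A pair treated differently in two words contains two
letters that are adjacent in one and d apart in the other, so different choices are separated; equal
choices are handled recursively (`HasArrayFamily.merge`). Stacking keeps w and joining doubles it.
At w = d the arrays are simply written one after another, each in one of two orientations
(`hasArrayFamily_solid`).

From N arrays, the binomial coefficient contributes almost 2^(N/2) and the two recursive calls, on
N/4 arrays each, almost 2^(N/4) apiece: one bit per array. The lost exponent is polynomial in log N
(`exists_large_arrayFamily`). Starting from 1 × 1 arrays gives the bound for n a power of 2;
concatenation extends it to all n. -/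

/-! ### Words as placements, and their concatenation -/

/-- `p` places the elements of `E` bijectively on the positions `0, …, |E| - 1`. -/
def IsWord {E : Type} [Fintype E] (p : E → ℕ) : Prop :=
  Function.Injective p ∧ ∀ x, p x < Fintype.card E

/-- Two elements are adjacent under one of the placements and at distance `d` under the other. -/
def DistSeparated {E : Type} (d : ℕ) (p q : E → ℕ) : Prop :=
  ∃ x y, (Nat.dist (p x) (p y) = 1 ∧ Nat.dist (q x) (q y) = d) ∨
    (Nat.dist (q x) (q y) = 1 ∧ Nat.dist (p x) (p y) = d)

/-- Writing a word on `E` followed by a word on `F`. -/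
def concatWord {E F : Type} [Fintype E] (p : E → ℕ) (q : F → ℕ) : E ⊕ F → ℕ :=
  Sum.elim p (fun y => Fintype.card E + q y)

theorem IsWord.concat {E F : Type} [Fintype E] [Fintype F] {p : E → ℕ} {q : F → ℕ} (hp : IsWord p) (hq : IsWord q) :
    IsWord (concatWord p q) := by
  constructor
  · rintro (x | x) (y | y) h
    · exact congrArg _ (hp.1 h)
    · have := hp.2 x
      simp only [concatWord, Sum.elim_inl, Sum.elim_inr] at h
      omega
    · have := hp.2 y
      simp only [concatWord, Sum.elim_inl, Sum.elim_inr] at h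
      omega
    · simp only [concatWord, Sum.elim_inr, Nat.add_left_cancel_iff] at h
      exact congrArg _ (hq.1 h)
  · rintro (x | x)
    · have := hp.2 x
      simp only [concatWord, Sum.elim_inl, Fintype.card_sum]
      omega
    · have := hq.2 x
      simp only [concatWord, Sum.elim_inr, Fintype.card_sum]
      omega

theorem dist_concatWord_inl {E F : Type} [Fintype E] (p : E → ℕ) (q : F → ℕ) (x y : E) :
    Nat.dist (concatWord p q (Sum.inl x)) (concatWord p q (Sum.inl y)) = Nat.dist (p x) (p y) :=
  rfl

theorem dist_concatWord_inr {E F : Type} [Fintype E] (p : E → ℕ) (q : F → ℕ) (x y : F) :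
    Nat.dist (concatWord p q (Sum.inr x)) (concatWord p q (Sum.inr y)) = Nat.dist (q x) (q y) := by
  simp [concatWord, Nat.dist_add_add_left]

theorem DistSeparated.concat_left {E F : Type} [Fintype E] {d : ℕ} {p p' : E → ℕ} (h : DistSeparated d p p')
    (q q' : F → ℕ) : DistSeparated d (concatWord p q) (concatWord p' q') := by
  obtain ⟨x, y, h⟩ := h
  exact ⟨Sum.inl x, Sum.inl y, h⟩

theorem DistSeparated.concat_right {E F : Type} [Fintype E] {d : ℕ} {q q' : F → ℕ} (h : DistSeparated d q q')
    (p p' : E → ℕ) : DistSeparated d (concatWord p q) (concatWord p' q') := by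
  obtain ⟨x, y, h⟩ := h
  refine ⟨Sum.inr x, Sum.inr y, ?_⟩
  simpa only [dist_concatWord_inr] using h

theorem IsWord.comp_equiv {E F : Type} [Fintype E] [Fintype F] {p : F → ℕ} (hp : IsWord p)
    (e : E ≃ F) : IsWord (p ∘ e) :=
  ⟨hp.1.comp e.injective, fun x => by rw [Fintype.card_congr e]; exact hp.2 _⟩

theorem DistSeparated.comp_surjective {E F : Type} {d : ℕ} {p q : F → ℕ}
    (h : DistSeparated d p q) {f : E → F} (hf : Function.Surjective f) :
    DistSeparated d (p ∘ f) (q ∘ f) := by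
  obtain ⟨x, y, h⟩ := h
  obtain ⟨x, rfl⟩ := hf x
  obtain ⟨y, rfl⟩ := hf y
  exact ⟨x, y, h⟩

/-! ### Words that keep arrays -/

/-- A placement under which every `h × w` array `(i, ·, ·)` has its rows contiguous and
consecutive rows at distance `d`. -/
structure KeepsArrays {I : Type} {h w : ℕ} (d : ℕ) (p : I × Fin h × Fin w → ℕ) : Prop where
  row : ∀ i r (c c' : Fin w), c.val + 1 = c'.val → Nat.dist (p (i, r, c)) (p (i, r, c')) = 1
  col : ∀ i (r r' : Fin h) c, r.val + 1 = r'.val → Nat.dist (p (i, r, c)) (p (i, r', c)) = d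

/-- On any `N` arrays of size `h × w` there are `M` pairwise separated words keeping them. -/
def HasArrayFamily (d h w N M : ℕ) : Prop :=
  ∀ (I : Type) [Fintype I], Fintype.card I = N →
    ∃ p : Fin M → I × Fin h × Fin w → ℕ,
      (∀ j, IsWord (p j)) ∧ (∀ j, KeepsArrays d (p j)) ∧
        Pairwise fun j j' => DistSeparated d (p j) (p j')

theorem hasArrayFamily_of_index {d h w N M : ℕ} {J : Type} [Fintype J] (hJ : Fintype.card J = M)
    (H : ∀ (I : Type) [Fintype I], Fintype.card I = N →
      ∃ p : J → I × Fin h × Fin w → ℕ,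
        (∀ j, IsWord (p j)) ∧ (∀ j, KeepsArrays d (p j)) ∧
          Pairwise fun j j' => DistSeparated d (p j) (p j')) :
    HasArrayFamily d h w N M := by
  intro I _ hI
  obtain ⟨p, h1, h2, h3⟩ := H I hI
  let e := (Fintype.equivFinOfCardEq hJ).symm
  exact ⟨p ∘ e, fun j => h1 _, fun j => h2 _, fun j j' hj => h3 (e.injective.ne hj)⟩

/-- Supplies the empty half of a merge in which no pair is stacked. -/
theorem hasArrayFamily_zero (d h w : ℕ) : HasArrayFamily d h w 0 1 := by
  intro I _ hI
  have : IsEmpty I := Fintype.card_eq_zero_iff.mp hI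
  refine ⟨fun _ _ => 0, fun _ => ⟨fun x => isEmptyElim x.1, fun x => isEmptyElim x.1⟩,
    fun _ => ⟨fun i => isEmptyElim i, fun i => isEmptyElim i⟩, fun j j' hj => ?_⟩
  exact absurd (Subsingleton.elim j j') hj

/-! ### Arrays of full width d -/

/-- Row by row concatenation of `h × d` arrays, the columns of array `i` being reversed
when `o i` holds. -/
def orientedWord {h d m : ℕ} (o : Fin m → Bool) (x : Fin m × Fin h × Fin d) : ℕ :=
  (x.1 * h + x.2.1) * d + (if o x.1 then x.2.2.rev else x.2.2 : Fin d)

theorem Nat.dist_eq_iff {a b c : ℕ} : Nat.dist a b = c ↔ a + c = b ∨ b + c = a := by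
  unfold Nat.dist; omega

theorem mul_add_inj_of_lt {d a b r s : ℕ} (hr : r < d) (hs : s < d)
    (h : a * d + r = b * d + s) : a = b ∧ r = s := by
  have h1 : (a * d + r) / d = a := by
    rw [mul_comm, Nat.mul_add_div (by omega), Nat.div_eq_of_lt hr, add_zero]
  have h2 : (b * d + s) / d = b := by
    rw [mul_comm, Nat.mul_add_div (by omega), Nat.div_eq_of_lt hs, add_zero]
  have : a = b := by rw [← h1, h, h2]
  subst this
  exact ⟨rfl, by omega⟩

theorem mul_add_lt_mul {a b m d : ℕ} (ha : a < m) (hb : b < d) : a * d + b < m * d := by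
  calc a * d + b < a * d + d := by omega
    _ = (a + 1) * d := by ring
    _ ≤ m * d := Nat.mul_le_mul_right _ ha

theorem isWord_orientedWord {h d m : ℕ} (o : Fin m → Bool) :
    IsWord (orientedWord (h := h) (d := d) o) := by
  constructor
  · rintro ⟨i, r, c⟩ ⟨i', r', c'⟩ hx
    simp only [orientedWord] at hx
    obtain ⟨h1, h2⟩ := mul_add_inj_of_lt (Fin.isLt _) (Fin.isLt _) hx
    obtain ⟨h3, h4⟩ := mul_add_inj_of_lt r.isLt r'.isLt h1
    obtain rfl := Fin.ext h3
    obtain rfl := Fin.ext h4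
    have h5 := Fin.ext h2
    split_ifs at h5
    · rw [Fin.rev_inj.mp h5]
    · rw [h5]
  · rintro ⟨i, r, c⟩
    simp only [orientedWord, Fintype.card_prod, Fintype.card_fin, ← mul_assoc]
    exact mul_add_lt_mul (mul_add_lt_mul i.isLt r.isLt) (Fin.isLt _)

theorem keepsArrays_orientedWord {h d m : ℕ} (o : Fin m → Bool) :
    KeepsArrays d (orientedWord (h := h) (d := d) o) := by
  constructor
  · intro i r c c' hc
    have := c'.isLt
    rw [Nat.dist_eq_iff]
    simp only [orientedWord]
    split_ifs <;> (try simp only [Fin.val_rev]) <;> omega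
  · intro i r r' c hr
    rw [Nat.dist_eq_iff]
    left
    simp only [orientedWord, ← hr]
    ring

/-- Just before the first array whose orientations differ stands one oriented alike in both words.
The last letter of the latter precedes a fixed corner of the former by 1 in one word and by d in the
other. -/
theorem distSeparated_orientedWord {h d m : ℕ} (hh : 0 < h) (hd : 0 < d)
    {o o' : Fin (m + 1) → Bool} (h0 : o 0 = o' 0) (hne : o ≠ o') :
    DistSeparated d (orientedWord (h := h) (d := d) o) (orientedWord (h := h) (d := d) o') := by
  have hex : ∃ i : ℕ, ∃ hi : i < m + 1, o ⟨i, hi⟩ ≠ o' ⟨i, hi⟩ := by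
    obtain ⟨i, hi⟩ := Function.ne_iff.mp hne
    exact ⟨i, i.isLt, hi⟩
  classical
  obtain ⟨hi, hoi⟩ := Nat.find_spec hex
  have hmin : ∀ j (hj : j < m + 1), j < Nat.find hex → o ⟨j, hj⟩ = o' ⟨j, hj⟩ := by
    intro j hj hlt
    by_contra hc
    exact Nat.find_min hex hlt ⟨hj, hc⟩
  generalize Nat.find hex = i at hi hoi hmin
  obtain _ | i := i
  · exact absurd h0 hoi
  have hi' : i < m + 1 := by omega
  have hprev := hmin i hi' (Nat.lt_succ_self i)
  -- The letter written last in array `i`; the common orientation decides its column.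
  let z : Fin (m + 1) × Fin h × Fin d := (⟨i, hi'⟩, ⟨h - 1, by omega⟩,
    if o ⟨i, hi'⟩ then ⟨0, hd⟩ else ⟨d - 1, by omega⟩)
  let x : Fin (m + 1) × Fin h × Fin d := (⟨i + 1, hi⟩, ⟨0, hh⟩, ⟨0, hd⟩)
  have hmul : (i * h + (h - 1)) * d + (d - 1) + 1 = (i + 1) * h * d := by
    obtain ⟨h, rfl⟩ : ∃ a, h = a + 1 := ⟨h - 1, by omega⟩
    obtain ⟨d, rfl⟩ : ∃ a, d = a + 1 := ⟨d - 1, by omega⟩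
    simp only [Nat.add_sub_cancel]
    ring
  have hz : ∀ u : Fin (m + 1) → Bool, u ⟨i, hi'⟩ = o ⟨i, hi'⟩ →
      orientedWord u z + 1 = (i + 1) * h * d := by
    intro u hu
    rw [← hmul]
    simp only [orientedWord, z, hu]
    split_ifs <;> simp [Fin.val_rev]
  have hx : ∀ u : Fin (m + 1) → Bool,
      orientedWord u x = (i + 1) * h * d + if u ⟨i + 1, hi⟩ then d - 1 else 0 := by
    intro u
    simp only [orientedWord, x]
    split_ifs <;> simp [Fin.val_rev]
  have hz1 := hz o rfl
  have hz2 := hz o' hprev.symm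
  have hx1 := hx o
  have hx2 := hx o'
  refine ⟨z, x, ?_⟩
  simp only [Nat.dist_eq_iff]
  generalize orientedWord o z = A at *
  generalize orientedWord o x = B at *
  generalize orientedWord o' z = C at *
  generalize orientedWord o' x = D at *
  generalize (i + 1) * h * d = K at *
  cases h1 : o ⟨i + 1, hi⟩ <;> cases h2 : o' ⟨i + 1, hi⟩ <;>
    simp only [h1, h2, if_true, Bool.false_eq_true, if_false, ne_eq, not_true_eq_false] at * <;>
    omega

theorem KeepsArrays.comp_index {I I' : Type} {h w d : ℕ} {p : I' × Fin h × Fin w → ℕ}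
    (hp : KeepsArrays d p) (e : I → I') :
    KeepsArrays d (fun x : I × Fin h × Fin w => p (e x.1, x.2)) :=
  ⟨fun i => hp.row (e i), fun i => hp.col (e i)⟩

theorem hasArrayFamily_solid {d h : ℕ} (hd : 0 < d) (hh : 0 < h) (n : ℕ) :
    HasArrayFamily d h d (n + 1) (2 ^ n) := by
  refine hasArrayFamily_of_index (J := Fin n → Bool) (by simp) ?_
  intro I _ hI
  let e := Fintype.equivFinOfCardEq hI
  let E : I × Fin h × Fin d ≃ Fin (n + 1) × Fin h × Fin d := e.prodCongr (Equiv.refl _)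
  -- The first array has no predecessor, so its orientation is fixed; this costs one bit.
  refine ⟨fun o => orientedWord (Fin.cons false o) ∘ E,
    fun o => (isWord_orientedWord _).comp_equiv E,
    fun o => (keepsArrays_orientedWord _).comp_index e, fun o o' ho => ?_⟩
  refine (distSeparated_orientedWord hh hd ?_ ?_).comp_surjective E.surjective
  · simp
  · intro hc
    exact ho (Fin.cons_injective2 hc).2

/-! ### Merging pairs of arrays -/

/-- The arrays indexed by `Q × Bool` come in pairs. The pairs in `S` are stacked into `(h + h) × w`
arrays (rows of the first and columns of the second reversed), the other pairs are put side by
side into `h × (w + w)` arrays. -/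
def mergePairs {Q : Type} [DecidableEq Q] {h w : ℕ} (S : Finset Q)
    (x : (Q × Bool) × Fin h × Fin w) :
    ({q // q ∈ S} × Fin (h + h) × Fin w) ⊕ ({q // q ∉ S} × Fin h × Fin (w + w)) :=
  if hq : x.1.1 ∈ S then
    Sum.inl (⟨x.1.1, hq⟩,
      if x.1.2 then (Fin.natAdd h x.2.1, x.2.2.rev) else (Fin.castAdd h x.2.1.rev, x.2.2))
  else
    Sum.inr (⟨x.1.1, hq⟩, x.2.1, if x.1.2 then Fin.natAdd w x.2.2 else Fin.castAdd w x.2.2)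

section merge

variable {Q : Type} [DecidableEq Q] {h w : ℕ}

theorem mergePairs_injective (S : Finset Q) :
    Function.Injective (mergePairs (h := h) (w := w) S) := by
  rintro ⟨⟨q, b⟩, r, c⟩ ⟨⟨q', b'⟩, r', c'⟩ hx
  have := r.isLt
  have := r'.isLt
  have := c.isLt
  have := c'.isLt
  by_cases hq : q ∈ S <;> by_cases hq' : q' ∈ S <;> cases b <;> cases b' <;>
    simp [mergePairs, hq, hq', Fin.ext_iff] at hx ⊢ <;> (try omega) <;>
    (refine ⟨hx.1, ?_, ?_⟩ <;> omega)

theorem card_mergePairs [Fintype Q] (S : Finset Q) :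
    Fintype.card ((Q × Bool) × Fin h × Fin w) =
      Fintype.card (({q // q ∈ S} × Fin (h + h) × Fin w) ⊕
        ({q // q ∉ S} × Fin h × Fin (w + w))) := by
  have h1 : Fintype.card {q // q ∈ S} + Fintype.card {q // q ∉ S} = Fintype.card Q := by
    rw [Fintype.card_subtype_compl, Fintype.card_coe]
    exact Nat.add_sub_cancel' (Finset.card_le_univ S)
  simp only [Fintype.card_sum, Fintype.card_prod, Fintype.card_fin, Fintype.card_bool, ← h1]
  ring

theorem mergePairs_surjective [Fintype Q] (S : Finset Q) :
    Function.Surjective (mergePairs (h := h) (w := w) S) :=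
  ((Fintype.bijective_iff_injective_and_card _).mpr
    ⟨mergePairs_injective S, card_mergePairs S⟩).2

theorem isWord_mergePairs [Fintype Q] (S : Finset Q)
    {p : {q // q ∈ S} × Fin (h + h) × Fin w → ℕ} {p' : {q // q ∉ S} × Fin h × Fin (w + w) → ℕ}
    (hp : IsWord p) (hp' : IsWord p') : IsWord (concatWord p p' ∘ mergePairs S) := by
  refine ⟨(hp.concat hp').1.comp (mergePairs_injective S), fun x => ?_⟩
  rw [card_mergePairs S]
  exact (hp.concat hp').2 _

theorem keepsArrays_mergePairs [Fintype Q] (S : Finset Q) {d : ℕ}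
    {p : {q // q ∈ S} × Fin (h + h) × Fin w → ℕ} {p' : {q // q ∉ S} × Fin h × Fin (w + w) → ℕ}
    (hp : KeepsArrays d p) (hp' : KeepsArrays d p') :
    KeepsArrays d (concatWord p p' ∘ mergePairs S) := by
  constructor
  · rintro ⟨q, b⟩ r c c' hc
    have := c'.isLt
    by_cases hq : q ∈ S <;> cases b <;>
      simp only [Function.comp, mergePairs, hq, dite_true, dite_false, if_true, if_false,
        Bool.false_eq_true, dist_concatWord_inl, dist_concatWord_inr]
    · exact hp.row _ _ _ _ hc
    · rw [Nat.dist_comm]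
      exact hp.row _ _ _ _ (by simp only [Fin.val_rev]; omega)
    · exact hp'.row _ _ _ _ (by simpa using hc)
    · exact hp'.row _ _ _ _ (by simp only [Fin.val_natAdd]; omega)
  · rintro ⟨q, b⟩ r r' c hr
    have := r'.isLt
    by_cases hq : q ∈ S <;> cases b <;>
      simp only [Function.comp, mergePairs, hq, dite_true, dite_false, if_true, if_false,
        Bool.false_eq_true, dist_concatWord_inl, dist_concatWord_inr]
    · rw [Nat.dist_comm]
      exact hp.col _ _ _ _ (by simp only [Fin.val_castAdd, Fin.val_rev]; omega)
    · exact hp.col _ _ _ _ (by simp only [Fin.val_natAdd]; omega)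
    · exact hp'.col _ _ _ _ hr
    · exact hp'.col _ _ _ _ hr

/-- Side by side, the end of row 0 of the first array touches the start of row 0 of the second. The
reversals in the stacked form put these same two letters one above the other. -/
theorem distSeparated_mergePairs_of_mem [Fintype Q] (hh : 0 < h) (hw : 0 < w) {S S' : Finset Q}
    {d : ℕ} {q : Q} (hq : q ∈ S) (hq' : q ∉ S')
    {p₁ : {q // q ∈ S} × Fin (h + h) × Fin w → ℕ} {p₂ : {q // q ∉ S} × Fin h × Fin (w + w) → ℕ}
    {p₁' : {q // q ∈ S'} × Fin (h + h) × Fin w → ℕ}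
    {p₂' : {q // q ∉ S'} × Fin h × Fin (w + w) → ℕ}
    (hp : KeepsArrays d p₁) (hp' : KeepsArrays d p₂') :
    DistSeparated d (concatWord p₁ p₂ ∘ mergePairs S) (concatWord p₁' p₂' ∘ mergePairs S') := by
  refine ⟨((q, false), ⟨0, hh⟩, ⟨w - 1, by omega⟩), ((q, true), ⟨0, hh⟩, ⟨0, hw⟩), Or.inr ⟨?_, ?_⟩⟩
  · simp only [Function.comp, mergePairs, hq', dite_false, if_true, if_false,
      Bool.false_eq_true, dist_concatWord_inr]
    exact hp'.row _ _ _ _ (by simp only [Fin.val_natAdd, Fin.val_castAdd]; omega)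
  · have hc : (⟨0, hw⟩ : Fin w).rev = ⟨w - 1, by omega⟩ := Fin.ext (by simp [Fin.val_rev])
    simp only [Function.comp, mergePairs, hq, dite_true, if_true, if_false,
      Bool.false_eq_true, dist_concatWord_inl, hc]
    exact hp.col _ _ _ _ (by simp only [Fin.val_natAdd, Fin.val_castAdd, Fin.val_rev]; omega)

end merge

theorem HasArrayFamily.merge {d h w s s' M M' : ℕ} (hh : 0 < h) (hw : 0 < w)
    (H : HasArrayFamily d (h + h) w s M) (H' : HasArrayFamily d h (w + w) s' M') :
    HasArrayFamily d h w (2 * (s + s')) ((s + s').choose s * (M * M')) := by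
  classical
  refine hasArrayFamily_of_index
    (J := {S : Finset (Fin (s + s')) // S.card = s} × Fin M × Fin M') ?_ ?_
  · simp [Fintype.card_finset_len]
  intro I _ hI
  have hcard : Fintype.card I = Fintype.card (Fin (s + s') × Bool) := by
    rw [hI]
    simp [mul_comm]
  let e := Fintype.equivOfCardEq hcard
  let E : I × Fin h × Fin w ≃ (Fin (s + s') × Bool) × Fin h × Fin w :=
    e.prodCongr (Equiv.refl _)
  have H1 := fun S : {S : Finset (Fin (s + s')) // S.card = s} =>
    H {q // q ∈ S.1} (by rw [Fintype.card_coe, S.2])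
  have H2 := fun S : {S : Finset (Fin (s + s')) // S.card = s} =>
    H' {q // q ∉ S.1} (by
      rw [Fintype.card_subtype_compl, Fintype.card_coe, S.2, Fintype.card_fin]
      omega)
  choose p hp using H1
  choose p' hp' using H2
  refine ⟨fun j => (concatWord (p j.1 j.2.1) (p' j.1 j.2.2) ∘ mergePairs j.1.1) ∘ E,
    fun j => (isWord_mergePairs _ ((hp _).1 _) ((hp' _).1 _)).comp_equiv E,
    fun j => (keepsArrays_mergePairs _ ((hp _).2.1 _) ((hp' _).2.1 _)).comp_index e, ?_⟩
  rintro ⟨S, a, b⟩ ⟨S', a', b'⟩ hne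
  refine DistSeparated.comp_surjective ?_ E.surjective
  by_cases hS : S = S'
  · subst hS
    refine DistSeparated.comp_surjective ?_ (mergePairs_surjective S.1)
    by_cases ha : a = a'
    · have hb : b ≠ b' := fun hb => hne (by rw [ha, hb])
      exact ((hp' S).2.2 hb).concat_right _ _
    · exact ((hp S).2.2 ha).concat_left _ _
  -- Distinct sets of equal size: some pair is stacked for `S` and side by side for `S'`.
  · have hnot : ¬ S.1 ⊆ S'.1 := fun hsub =>
      hS (Subtype.ext (Finset.eq_of_subset_of_card_le hsub (by rw [S.2, S'.2])))
    obtain ⟨q, hq, hq'⟩ := Finset.not_subset.mp hnot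
    exact distSeparated_mergePairs_of_mem hh hw hq hq' ((hp S).2.1 a) ((hp' S').2.1 b')

/-! ### Counting the words -/

/-- Joining all pairs side by side, `b` times over, reaches width d. -/
theorem exists_hasArrayFamily_pos {d : ℕ} (hd : 0 < d) (b : ℕ) :
    ∀ w h N : ℕ, w * 2 ^ b = d → 0 < h → 0 < N →
      ∃ M, 0 < M ∧ HasArrayFamily d h w (2 ^ b * N) M := by
  induction b with
  | zero =>
    intro w h N hw hh hN
    obtain ⟨n, rfl⟩ : ∃ n, N = n + 1 := ⟨N - 1, by omega⟩
    obtain rfl : w = d := by simpa using hw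
    exact ⟨2 ^ n, by positivity, by simpa using hasArrayFamily_solid hd hh n⟩
  | succ b ih =>
    intro w h N hw hh hN
    have hw0 : 0 < w := Nat.pos_of_ne_zero (by rintro rfl; simp at hw; omega)
    obtain ⟨M, hM, H⟩ := ih (w + w) h N (by rw [← hw]; ring) hh hN
    refine ⟨M, hM, ?_⟩
    have := (hasArrayFamily_zero d (h + h) w).merge hh hw0 H
    simpa [pow_succ', mul_assoc] using this

theorem two_pow_le_choose_mul (t : ℕ) :
    2 ^ 2 ^ (t + 1) ≤ (2 ^ t + 2 ^ t).choose (2 ^ t) * 2 ^ (t + 1) := by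
  have h := Nat.four_pow_le_two_mul_self_mul_centralBinom (2 ^ t) (by positivity)
  rw [Nat.centralBinom] at h
  calc 2 ^ 2 ^ (t + 1) = 4 ^ 2 ^ t := by
        rw [show (4 : ℕ) = 2 ^ 2 by norm_num, ← pow_mul, pow_succ']
    _ ≤ 2 * 2 ^ t * (2 * 2 ^ t).choose (2 ^ t) := h
    _ = _ := by rw [← two_mul]; ring

/-- With L(b, t) = 2^(b+1) (t+1)^(b+1), this is (t+1) + L(b+1, t) + L(b, t) ≤ L(b+1, t+2), the loss
recursion of a merge. -/
theorem lossBound_step (b t : ℕ) :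
    (t + 1) + 2 ^ (b + 2) * (t + 1) ^ (b + 2) + 2 ^ (b + 1) * (t + 1) ^ (b + 1) ≤
      2 ^ (b + 2) * (t + 3) ^ (b + 2) := by
  have h1 : (t + 1) ^ (b + 1) ≤ (t + 3) ^ (b + 1) := Nat.pow_le_pow_left (by omega) _
  have h2 : t + 1 ≤ (t + 1) ^ (b + 1) := Nat.le_self_pow (by omega) _
  have h3 : 1 ≤ 2 ^ (b + 1) := Nat.one_le_two_pow
  have h4 : (t + 1) ^ (b + 2) + 2 * (t + 1) ^ (b + 1) ≤ (t + 3) ^ (b + 2) := by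
    calc (t + 1) ^ (b + 2) + 2 * (t + 1) ^ (b + 1) = (t + 3) * (t + 1) ^ (b + 1) := by ring
      _ ≤ (t + 3) * (t + 3) ^ (b + 1) := Nat.mul_le_mul_left _ h1
      _ = _ := by ring
  have h5 : t + 1 ≤ 2 ^ (b + 1) * (t + 1) ^ (b + 1) :=
    h2.trans (Nat.le_mul_of_pos_left _ (by omega))
  calc (t + 1) + 2 ^ (b + 2) * (t + 1) ^ (b + 2) + 2 ^ (b + 1) * (t + 1) ^ (b + 1)
      ≤ 2 ^ (b + 2) * ((t + 1) ^ (b + 2) + 2 * (t + 1) ^ (b + 1)) := by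
        have : 2 ^ (b + 2) * (2 * (t + 1) ^ (b + 1)) =
          4 * (2 ^ (b + 1) * (t + 1) ^ (b + 1)) := by ring
        rw [mul_add, this]
        omega
    _ ≤ _ := Nat.mul_le_mul_left _ h4

theorem mul_two_pow_mul_mul_two_pow (C M M' x y z : ℕ) :
    C * 2 ^ x * (M * 2 ^ y * (M' * 2 ^ z)) = C * (M * M') * 2 ^ (x + y + z) := by
  ring

/-- Array families of size `2 ^ (2 ^ t)` up to a factor `2 ^ poly t`. -/
theorem exists_large_arrayFamily {d : ℕ} (hd : 0 < d) (b : ℕ) :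
    ∀ t w h : ℕ, w * 2 ^ b = d → 0 < h → b ≤ t →
      ∃ M, HasArrayFamily d h w (2 ^ t) M ∧
        2 ^ 2 ^ t ≤ M * 2 ^ (2 ^ (b + 1) * (t + 1) ^ (b + 1)) := by
  induction b with
  | zero =>
    intro t w h hw hh _
    obtain rfl : w = d := by simpa using hw
    obtain ⟨n, hn⟩ : ∃ n, 2 ^ t = n + 1 := ⟨2 ^ t - 1, by have := Nat.one_le_two_pow (n := t); omega⟩
    refine ⟨2 ^ n, hn ▸ hasArrayFamily_solid hd hh n, ?_⟩
    rw [← pow_add, hn]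
    exact Nat.pow_le_pow_right (by norm_num) (by simp; omega)
  | succ b ihb =>
    intro t
    induction t using Nat.strong_induction_on with
    | _ t iht =>
      intro w h hw hh ht
      have hw0 : 0 < w := Nat.pos_of_ne_zero (by rintro rfl; simp at hw; omega)
      -- For small `t` the allowed loss already exceeds 2^t, so any nonempty family will do.
      by_cases hbt : t ≤ b + 2
      · obtain ⟨M, hM, H⟩ := exists_hasArrayFamily_pos hd (b + 1) w h (2 ^ (t - (b + 1))) hw hh
          (by positivity)
        rw [← pow_add, Nat.add_sub_cancel' ht] at H
        refine ⟨M, H, le_trans ?_ (Nat.le_mul_of_pos_left _ hM)⟩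
        refine Nat.pow_le_pow_right (by norm_num) ?_
        exact (Nat.pow_le_pow_right (by norm_num) hbt).trans
          (Nat.le_mul_of_pos_right _ (by positivity))
      -- The 2^(t+2) arrays form 2^(t+1) pairs; 2^t are stacked and 2^t joined.
      · obtain ⟨t, rfl⟩ : ∃ u, t = u + 2 := ⟨t - 2, by omega⟩
        obtain ⟨M, H, hM⟩ := iht t (by omega) w (h + h) hw (by omega) (by omega)
        obtain ⟨M', H', hM'⟩ := ihb t (w + w) h (by rw [← hw]; ring) hh (by omega)
        have hmerge := H.merge hh hw0 H'
        rw [show 2 * (2 ^ t + 2 ^ t) = 2 ^ (t + 2) by ring] at hmerge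
        refine ⟨_, hmerge, ?_⟩
        have hcount := calc 2 ^ 2 ^ (t + 2)
            _ = 2 ^ 2 ^ (t + 1) * (2 ^ 2 ^ t * 2 ^ 2 ^ t) := by
              rw [← pow_add, ← pow_add]; ring_nf
            _ ≤ (2 ^ t + 2 ^ t).choose (2 ^ t) * 2 ^ (t + 1) *
                (M * 2 ^ (2 ^ (b + 1 + 1) * (t + 1) ^ (b + 1 + 1)) *
                  (M' * 2 ^ (2 ^ (b + 1) * (t + 1) ^ (b + 1)))) :=
              Nat.mul_le_mul (two_pow_le_choose_mul t) (Nat.mul_le_mul hM hM')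
            _ = (2 ^ t + 2 ^ t).choose (2 ^ t) * (M * M') *
                2 ^ ((t + 1) + 2 ^ (b + 2) * (t + 1) ^ (b + 2) +
                  2 ^ (b + 1) * (t + 1) ^ (b + 1)) := mul_two_pow_mul_mul_two_pow _ _ _ _ _ _
            _ ≤ (2 ^ t + 2 ^ t).choose (2 ^ t) * (M * M') *
                2 ^ (2 ^ (b + 2) * (t + 3) ^ (b + 2)) := Nat.mul_le_mul_left _
              (Nat.pow_le_pow_right (by norm_num) (lossBound_step b t))
        exact hcount

/-! ### Bounds for the maximal number of permutations -/

theorem neighborSeparated_iff {n d : ℕ} (π σ : Equiv.Perm (Fin n)) :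
    NeighborSeparated (d + 1) π σ ↔
      DistSeparated d (fun x => (π.symm x : ℕ)) (fun x => (σ.symm x : ℕ)) := by
  simp only [NeighborSeparated, DistSeparated, posDist, Nat.add_right_cancel_iff]

/-- The permutation whose word is given by the placement `p`. -/
theorem IsWord.exists_perm {n : ℕ} {p : Fin n → ℕ} (hp : IsWord p) :
    ∃ π : Equiv.Perm (Fin n), (fun x => (π.symm x : ℕ)) = p := by
  let f : Fin n → Fin n := fun x => ⟨p x, by simpa using hp.2 x⟩
  have hf : Function.Bijective f := Finite.injective_iff_bijective.mp fun x y hxy =>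
    hp.1 (Fin.mk.inj_iff.mp hxy)
  exact ⟨(Equiv.ofBijective f hf).symm, rfl⟩

theorem card_le_maxSeparated {E J : Type} [Fintype E] [Fintype J] {n d : ℕ} (hd : 1 < d)
    (hE : Fintype.card E = n) (p : J → E → ℕ) (hp : ∀ j, IsWord (p j))
    (hsep : Pairwise fun j j' => DistSeparated d (p j) (p j')) :
    Fintype.card J ≤ maxSeparated n (d + 1) := by
  classical
  let e := (Fintype.equivFinOfCardEq hE).symm
  choose π hπ using fun j => ((hp j).comp_equiv e).exists_perm
  have hns : ∀ j j', j ≠ j' → NeighborSeparated (d + 1) (π j) (π j') := by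
    intro j j' hj
    rw [neighborSeparated_iff, hπ, hπ]
    exact (hsep hj).comp_surjective e.surjective
  -- As d ≠ 1, no permutation is separated from itself.
  have hinj : Function.Injective π := by
    intro j j' h
    by_contra hj
    obtain ⟨x, y, hxy⟩ := hns j j' hj
    rw [h] at hxy
    omega
  refine (maxSeparated_isGreatest n (d + 1)).2 ⟨Finset.univ.image π, ?_, ?_⟩
  · intro σ hσ τ hτ hne
    simp only [Finset.coe_image, Finset.coe_univ, Set.image_univ, Set.mem_range] at hσ hτ
    obtain ⟨j, rfl⟩ := hσ
    obtain ⟨j', rfl⟩ := hτ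
    exact hns j j' fun h => hne (by rw [h])
  · rw [Finset.card_image_of_injective _ hinj, Finset.card_univ]

theorem exists_words_card_maxSeparated (n d : ℕ) :
    ∃ (J : Type) (_ : Fintype J) (p : J → Fin n → ℕ), Fintype.card J = maxSeparated n (d + 1) ∧
      (∀ j, IsWord (p j)) ∧ Pairwise fun j j' => DistSeparated d (p j) (p j') := by
  obtain ⟨F, hF, hcard⟩ := (maxSeparated_isGreatest n (d + 1)).1
  refine ⟨F, inferInstance, fun π x => (π.1.symm x : ℕ), by simpa using hcard, fun π => ⟨?_, ?_⟩, ?_⟩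
  · exact fun x y h => π.1.symm.injective (Fin.ext h)
  · intro x
    simp
  · intro π σ h
    rw [← neighborSeparated_iff]
    exact hF π.2 σ.2 fun hc => h (Subtype.ext hc)

theorem maxSeparated_mul_le {d : ℕ} (hd : 1 < d) (a b : ℕ) :
    maxSeparated a (d + 1) * maxSeparated b (d + 1) ≤ maxSeparated (a + b) (d + 1) := by
  obtain ⟨J, _, p, hJ, hp, hps⟩ := exists_words_card_maxSeparated a d
  obtain ⟨K, _, q, hK, hq, hqs⟩ := exists_words_card_maxSeparated b d
  rw [← hJ, ← hK, ← Fintype.card_prod]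
  refine card_le_maxSeparated hd (E := Fin a ⊕ Fin b) (by simp)
    (fun j : J × K => concatWord (p j.1) (q j.2)) (fun j => (hp _).concat (hq _)) ?_
  rintro ⟨i, j⟩ ⟨i', j'⟩ hne
  by_cases hi : i = i'
  · exact (hqs fun hj => hne (Prod.ext hi hj)).concat_right _ _
  · exact (hps hi).concat_left _ _

theorem one_le_maxSeparated (n k : ℕ) : 1 ≤ maxSeparated n k :=
  (maxSeparated_isGreatest n k).2 ⟨{1}, by simp [IsSeparatedFamily], by simp⟩

theorem pow_le_maxSeparated {d : ℕ} (hd : 1 < d) (a q r : ℕ) :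
    maxSeparated a (d + 1) ^ q ≤ maxSeparated (a * q + r) (d + 1) := by
  induction q with
  | zero => simpa using one_le_maxSeparated _ _
  | succ q ih =>
    rw [pow_succ']
    refine (Nat.mul_le_mul_left _ ih).trans ((maxSeparated_mul_le hd _ _).trans (le_of_eq ?_))
    congr 1
    ring

/-- For even `d`, the parities of the positions determine a member of a separated family. -/
theorem maxSeparated_le_two_pow {d : ℕ} (hd : Even d) (n : ℕ) :
    maxSeparated n (d + 1) ≤ 2 ^ n := by
  obtain ⟨J, _, p, hJ, -, hps⟩ := exists_words_card_maxSeparated n d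
  rw [← hJ]
  have hinj : Function.Injective fun (j : J) (x : Fin n) => decide (p j x % 2 = 0) := by
    intro j j' h
    by_contra hj
    obtain ⟨x, y, hxy⟩ := hps hj
    have hx : (p j x % 2 = 0) ↔ (p j' x % 2 = 0) := by simpa using congrFun h x
    have hy : (p j y % 2 = 0) ↔ (p j' y % 2 = 0) := by simpa using congrFun h y
    -- Adjacent positions differ in parity, while positions at even distance agree.
    obtain ⟨c, rfl⟩ := hd
    simp only [Nat.dist_eq_iff] at hxy
    omega
  simpa using Fintype.card_le_of_injective _ hinj

theorem two_pow_two_pow_le_maxSeparated {l : ℕ} (hl : 1 ≤ l) {t : ℕ} (ht : l ≤ t) :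
    2 ^ 2 ^ t ≤ maxSeparated (2 ^ t) (2 ^ l + 1) * 2 ^ (2 ^ (l + 1) * (t + 1) ^ (l + 1)) := by
  -- Single letters are 1 × 1 arrays, on which keeping arrays is no constraint.
  obtain ⟨M, H, hM⟩ := exists_large_arrayFamily (d := 2 ^ l) (by positivity) l t 1 1 (by simp)
    one_pos ht
  refine hM.trans (Nat.mul_le_mul_right _ ?_)
  obtain ⟨p, hp, -, hps⟩ := H (Fin (2 ^ t)) (by simp)
  simpa using card_le_maxSeparated (Nat.one_lt_two_pow (by omega)) (by simp) p hp hps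

/-! ### The defect is o(n) -/

open Filter Topology in
theorem tendsto_loss_div (l : ℕ) :
    Tendsto (fun t : ℕ => (2 ^ (l + 1) * ((t : ℝ) + 1) ^ (l + 1)) / 2 ^ t) atTop (𝓝 0) := by
  have h := (tendsto_pow_const_div_const_pow_of_one_lt (l + 1) (r := (2 : ℝ)) (by norm_num))
  have h2 := ((tendsto_add_atTop_iff_nat 1).mpr h).const_mul (2 ^ (l + 2) : ℝ)
  rw [mul_zero] at h2
  refine h2.congr fun t => ?_
  push_cast
  field_simp
  ring

/-- The defect of `log₂ P(n, 2 ^ l + 1)` from `n`. -/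
noncomputable def separationDefect (l n : ℕ) : ℝ :=
  n - Real.logb 2 (maxSeparated n (2 ^ l + 1))

theorem maxSeparated_eq_rpow (l n : ℕ) :
    (maxSeparated n (2 ^ l + 1) : ℝ) = (2 : ℝ) ^ ((n : ℝ) - separationDefect l n) := by
  have h : (0 : ℝ) < maxSeparated n (2 ^ l + 1) := by
    exact_mod_cast one_le_maxSeparated n (2 ^ l + 1)
  rw [separationDefect, sub_sub_cancel, Real.rpow_logb (by norm_num) (by norm_num) h]

theorem separationDefect_nonneg {l : ℕ} (hl : 1 ≤ l) (n : ℕ) : 0 ≤ separationDefect l n := by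
  have h1 : (0 : ℝ) < maxSeparated n (2 ^ l + 1) := by
    exact_mod_cast one_le_maxSeparated n (2 ^ l + 1)
  have h2 : (maxSeparated n (2 ^ l + 1) : ℝ) ≤ (2 : ℝ) ^ (n : ℝ) := by
    rw [Real.rpow_natCast]
    exact_mod_cast maxSeparated_le_two_pow ((Nat.even_pow' (by omega)).mpr even_two) n
  rw [separationDefect, sub_nonneg]
  exact (Real.logb_le_iff_le_rpow (by norm_num) h1).mpr h2

theorem separationDefect_two_pow_le {l : ℕ} (hl : 1 ≤ l) {t : ℕ} (ht : l ≤ t) :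
    separationDefect l (2 ^ t) ≤ 2 ^ (l + 1) * ((t : ℝ) + 1) ^ (l + 1) := by
  have h := two_pow_two_pow_le_maxSeparated hl ht
  have h' : (2 : ℝ) ^ ((2 ^ t : ℕ) : ℝ) ≤ (2 : ℝ) ^ (((2 ^ t : ℕ) : ℝ) -
      separationDefect l (2 ^ t) + ((2 ^ (l + 1) * (t + 1) ^ (l + 1) : ℕ) : ℝ)) := by
    rw [Real.rpow_add (by norm_num), ← maxSeparated_eq_rpow, Real.rpow_natCast, Real.rpow_natCast]
    exact_mod_cast h
  have h2 := (Real.rpow_le_rpow_left_iff (by norm_num)).mp h'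
  push_cast at h2
  linarith

/-- Concatenation adds defects, and each leftover letter costs at most one bit. -/
theorem separationDefect_mul_add_le {l : ℕ} (hl : 1 ≤ l) (a q r : ℕ) :
    separationDefect l (a * q + r) ≤ q * separationDefect l a + r := by
  have h := pow_le_maxSeparated (Nat.one_lt_two_pow (n := l) (by omega)) a q r
  have h' : ((maxSeparated a (2 ^ l + 1) : ℝ)) ^ (q : ℝ) ≤
      maxSeparated (a * q + r) (2 ^ l + 1) := by
    rw [Real.rpow_natCast]
    exact_mod_cast h
  rw [maxSeparated_eq_rpow, maxSeparated_eq_rpow, ← Real.rpow_mul (by norm_num),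
    Real.rpow_le_rpow_left_iff (by norm_num)] at h'
  push_cast at h'
  nlinarith

theorem separationDefect_isLittleO {l : ℕ} (hl : 1 ≤ l) :
    (separationDefect l) =o[Filter.atTop] fun n : ℕ => (n : ℝ) := by
  rw [Asymptotics.isLittleO_iff]
  intro ε hε
  -- Blocks of length 2^t lose less than ε/2 per letter.
  obtain ⟨t, htl, ht⟩ := ((Filter.eventually_ge_atTop l).and
    ((tendsto_loss_div l).eventually (gt_mem_nhds (half_pos hε)))).exists
  rw [div_lt_iff₀ (by positivity)] at ht
  -- From `n₀` on, the fewer than 2^t leftover letters cost at most εn/2.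
  obtain ⟨n₀, hn₀⟩ := exists_nat_ge ((2 : ℝ) ^ t / (ε / 2))
  filter_upwards [Filter.eventually_ge_atTop n₀] with n hn
  have hdef := separationDefect_two_pow_le hl htl
  have hle := separationDefect_mul_add_le hl (2 ^ t) (n / 2 ^ t) (n % 2 ^ t)
  rw [Nat.div_add_mod] at hle
  have hr : ((n % 2 ^ t : ℕ) : ℝ) ≤ 2 ^ t := by
    exact_mod_cast (Nat.mod_lt n (by positivity)).le
  have hq : (2 : ℝ) ^ t * ((n / 2 ^ t : ℕ) : ℝ) ≤ n := by
    exact_mod_cast Nat.mul_div_le n (2 ^ t)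
  have hn' : (2 : ℝ) ^ t ≤ ε / 2 * n := by
    have : (2 : ℝ) ^ t / (ε / 2) ≤ n := hn₀.trans (by exact_mod_cast hn)
    rw [div_le_iff₀ (by positivity)] at this
    linarith
  rw [Real.norm_of_nonneg (separationDefect_nonneg hl n), Real.norm_of_nonneg (by positivity)]
  have hmain : ((n / 2 ^ t : ℕ) : ℝ) * separationDefect l (2 ^ t) ≤ ε / 2 * n :=
    calc ((n / 2 ^ t : ℕ) : ℝ) * separationDefect l (2 ^ t)
        ≤ ((n / 2 ^ t : ℕ) : ℝ) * (ε / 2 * 2 ^ t) := by gcongr; linarith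
      _ = ε / 2 * (2 ^ t * ((n / 2 ^ t : ℕ) : ℝ)) := by ring
      _ ≤ ε / 2 * n := by gcongr
  linarith

theorem theorem1p4 (l : ℕ) (hl : 1 ≤ l) :
    Filter.Tendsto (fun n : ℕ => (maxSeparated n (2 ^ l + 1) : ℝ) ^ (1 / (n : ℝ)))
      Filter.atTop (nhds 2) ∧
    ∃ f : ℕ → ℝ, (f =o[Filter.atTop] fun n : ℕ => (n : ℝ)) ∧
      ∀ n : ℕ, (maxSeparated n (2 ^ l + 1) : ℝ) = (2 : ℝ) ^ ((n : ℝ) - f n) := by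
  have ho := separationDefect_isLittleO hl
  refine ⟨?_, separationDefect l, ho, maxSeparated_eq_rpow l⟩
  have hexp : Filter.Tendsto (fun n : ℕ => (2 : ℝ) ^ (1 - separationDefect l n / n))
      Filter.atTop (nhds 2) := by
    have h1 : Filter.Tendsto (fun n : ℕ => 1 - separationDefect l n / n) Filter.atTop (nhds 1) := by
      simpa using ho.tendsto_div_nhds_zero.const_sub 1
    have h2 := ((Real.continuous_const_rpow (a := 2) (by norm_num)).tendsto 1).comp h1
    simpa [Function.comp_def] using h2
  refine hexp.congr' ?_
  filter_upwards [Filter.eventually_gt_atTop 0] with n hn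
  have hn' : (n : ℝ) ≠ 0 := by exact_mod_cast hn.ne'
  rw [maxSeparated_eq_rpow, ← Real.rpow_mul (by norm_num)]
  congr 1
  field_simp
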